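/- Let $K\ge 1$, let $P$ be a real $n\times N$ matrix, let $S_1,\dots,S_K$ be symmetric positive semidefinite $N\times N$ matrices with $\sum_k S_k\succ 0$, and let $\mathcal T\subset\mathbb R_+^K$ be a nonempty convex compact set which intersects the interior of $\mathbb R_+^K$ and is monotone ($0\le t\le t'$ and $t'\in\mathcal T$ imply $t\in\mathcal T$). For $\rho>0$ let $$\mathcal D[\rho]=\{\zeta\in\mathbb R^n:\ \exists z\in\mathbb R^N,\ t\in\mathcal T:\ \zeta=Pz,\ z^{\mathrm T}S_kz\le \rho\, t_k,\ k=1,\dots,K\},$$ and let $\phi_{\mathcal T}(\lambda)=\max_{t\in\mathcal T}\lambda^{\mathrm T}t$. For a symmetric $n\times n$ matrix $X$, a vector $x\in\mathbb R^n$ and $\xi\in\mathbb R$, consider the semi-infinite constraint $$\forall \zeta\in\mathcal D[\rho]:\quad \zeta^{\mathrm T}X\zeta+2x^{\mathrm T}\zeta\le\xi\qquad (C[\rho])$$ and the system of constraints in the variables $X,x,\xi$, $\lambda\in\mathbb R^K$, $\tau\in\mathbb R$ $$\lambda_k\ge 0\ (k\le K),\qquad \begin{bmatrix}\sum_k\lambda_kS_k-P^{\mathrm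 T}XP & -P^{\mathrm T}x\\ -x^{\mathrm T}P&\tau\end{bmatrix}\succeq 0,\qquad \rho\,\phi_{\mathcal T}(\lambda)+\tau\le\xi .\qquad (S[\rho])$$ Then for every $\rho>0$ the set of feasible solutions $(X,x,\xi,\lambda,\tau)$ of $(S[\rho])$ is convex, and: (i) $(S[\rho])$ is a safe approximation of $(C[\rho])$: whenever $(X,x,\xi)$ can be augmented by some $\lambda,\tau$ to a feasible solution of $(S[\rho])$, $(X,x,\xi)$ is feasible for $(C[\rho])$. (ii) The approximation is tight within the factor $\varkappa=3\ln(6K)$: whenever $(X,x,\xi)$ cannot be augmented by any $\lambda,\tau$ to a feasible solution of $(S[\rho])$, $(X,x,\xi)$ is not feasible for $(C[\varkappa\rho])$. -/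

import Mathlib

open Matrix

/-- The data of a family of similar ellitopes in `ℝⁿ`: an `n × N` matrix `P`, positive semidefinite
`N × N` matrices `S 1, …, S K` with positive definite sum, and a nonempty convex compact monotone
set `T` in the nonnegative orthant of `ℝᴷ` which meets the interior of that orthant. -/
structure Ellitope (n N K : ℕ) where
  /-- the matrix of the linear parametrization `ζ = P z` -/
  P : Matrix (Fin n) (Fin N) ℝ
  /-- the matrices of the quadratic forms bounding `z` -/
  S : Fin K → Matrix (Fin N) (Fin N) ℝ
  /-- the set of admissible bounds -/
  T : Set (Fin K → ℝ)
  S_posSemidef : ∀ k, (S k).PosSemidef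
  sum_S_posDef : (∑ k, S k).PosDef
  T_nonempty : T.Nonempty
  T_convex : Convex ℝ T
  T_compact : IsCompact T
  T_nonneg : T ⊆ {t | 0 ≤ t}
  T_interior : (T ∩ interior {t : Fin K → ℝ | 0 ≤ t}).Nonempty
  T_monotone : ∀ t t' : Fin K → ℝ, 0 ≤ t → t ≤ t' → t' ∈ T → t ∈ T

namespace Ellitope

variable {n N K : ℕ}

/-- The uncertainty set `𝒟[ρ]`. -/
def uncertaintySet (E : Ellitope n N K) (ρ : ℝ) : Set (Fin n → ℝ) :=
  {ζ | ∃ z : Fin N → ℝ, ∃ t ∈ E.T, ζ = E.P *ᵥ z ∧ ∀ k, (E.S k *ᵥ z) ⬝ᵥ z ≤ t k * ρ}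

/-- The support function `φ_T(l) = max_{t ∈ T} lᵀ t` (`T` is nonempty and compact, so that the
supremum is a maximum). -/
noncomputable def supportFun (E : Ellitope n N K) (l : Fin K → ℝ) : ℝ :=
  sSup ((fun t => l ⬝ᵥ t) '' E.T)

/-- `(X, x, ξ)` is feasible for the semi-infinite constraint `C[ρ]`:
`ζᵀ X ζ + 2 xᵀ ζ ≤ ξ` for every `ζ ∈ 𝒟[ρ]`. -/
def RobustFeasible (E : Ellitope n N K) (ρ : ℝ) (X : Matrix (Fin n) (Fin n) ℝ) (x : Fin n → ℝ)
    (ξ : ℝ) : Prop :=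
  ∀ ζ ∈ E.uncertaintySet ρ, ζ ⬝ᵥ (X *ᵥ ζ) + 2 * (x ⬝ᵥ ζ) ≤ ξ

/-- The symmetric block matrix `[∑ₖ lₖ Sₖ - Pᵀ X P, -Pᵀ x; -xᵀ P, τ]`. -/
def lmiMatrix (E : Ellitope n N K) (X : Matrix (Fin n) (Fin n) ℝ) (x : Fin n → ℝ)
    (l : Fin K → ℝ) (τ : ℝ) : Matrix (Fin N ⊕ Unit) (Fin N ⊕ Unit) ℝ :=
  fromBlocks
    ((∑ k, l k • E.S k) - E.Pᵀ * X * E.P) (-(replicateCol Unit (E.Pᵀ *ᵥ x)))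
    (-(replicateRow Unit (x ᵥ* E.P)))     (of fun _ _ => τ)

/-- `(X, x, ξ, l, τ)` is feasible for the system `S[ρ]`. -/
structure SystemFeasible (E : Ellitope n N K) (ρ : ℝ) (X : Matrix (Fin n) (Fin n) ℝ)
    (x : Fin n → ℝ) (ξ : ℝ) (l : Fin K → ℝ) (τ : ℝ) : Prop where
  nonneg : ∀ k, 0 ≤ l k
  lmi : (E.lmiMatrix X x l τ).PosSemidef
  bound : ρ * E.supportFun l + τ ≤ ξ

end Ellitope

/-!
Convexity holds because the matrix of the system is linear in its variables and `φ_T` is a supremum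
of linear functions. Safety is the matrix inequality evaluated at `(z, 1)`.

For tightness, let the system be infeasible. The case `ξ < 0` is settled by `ζ = 0`. Otherwise the
multipliers with `ρ φ_T(l) + τ ≤ ξ` form a compact convex set whose image under the matrix map
misses the closed cone of positive semidefinite matrices. Separating the two
(`Matrix.exists_posSemidef_trace_mul_le`), and `T` from points outside it, gives a solution of the
dual problem (`Ellitope.exists_dual_solution`): a positive semidefinite matrix `Z` with corner
entry `1` and a vector `t ∈ T` such that `tr (S k Z) ≤ ρ t k`, while `tr (B Z) > ξ` for the matrix
`B` of the homogenized objective.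

The matrix `Z` is rounded to a vector (`Matrix.PosSemidef.exists_rounding`). Write `Z = C Cᵀ` with
`Cᵀ B C` diagonal and put `w = C ε` with random signs `ε`. Then `wᵀ B w = tr (B Z)` for every `ε`.
The last coordinate `s` of `w` is a signed sum of unit variance, and
`P(|s| ≤ 1) ≥ 1 / 3` (`one_third_le_expect_abs_le_one`). For a quadratic form `q ≥ 0` of mean `m`
one has `𝔼 exp (q / (3 m)) ≤ √3` (`expect_exp_sum_sq_div_le`), so each of the `K` forms exceeds its
mean by the factor `3 log (6 K)` with probability at most `√3 / (6 K)`. As `√3 / 6 < 1 / 3`, some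
`ε` is good for all requirements. Since `|s| ≤ 1`, one of `ζ = P z` and `ζ = -P z`, where `z` is the
remaining part of `w`, violates the constraint.
-/

/-! ### Moments of signed sums -/

section Rademacher
open scoped BigOperators
open Finset

variable {ι : Type*} [Fintype ι] [DecidableEq ι]

/-- Flipping a fixed set of signs (those with `g i = -1`) preserves the uniform distribution on sign
vectors. -/
theorem expect_flip_sign (g : ι → ℤˣ) (F : (ι → ℤˣ) → ℝ) :
    𝔼 ε, F (g * ε) = 𝔼 ε, F ε :=
  Fintype.expect_equiv (Equiv.mulLeft g) _ _ fun _ => rfl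

/-- Averaging over the sign of a single coordinate `j`. -/
theorem expect_signed_sum_insert (a : ι → ℝ) (F : ℝ → ℝ) {s : Finset ι} {j : ι} (hj : j ∉ s) :
    𝔼 ε : ι → ℤˣ, F (∑ i ∈ insert j s, a i * ((ε i : ℤ) : ℝ)) =
      𝔼 ε : ι → ℤˣ, (F (∑ i ∈ s, a i * ((ε i : ℤ) : ℝ) + a j) +
        F (∑ i ∈ s, a i * ((ε i : ℤ) : ℝ) - a j)) / 2 := by
  set G : (ι → ℤˣ) → ℝ := fun ε => F (∑ i ∈ insert j s, a i * ((ε i : ℤ) : ℝ)) with hG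
  have h1 := expect_flip_sign (Pi.mulSingle j (-1)) G
  have h2 : 𝔼 ε, G ε = 𝔼 ε, (G ε + G (Pi.mulSingle j (-1) * ε)) / 2 := by
    rw [← expect_div, expect_add_distrib, h1]
    ring
  change 𝔼 ε, G ε = _
  rw [h2]
  refine expect_congr rfl fun ε _ => ?_
  have h3 : ∑ i ∈ s, a i * ((((Pi.mulSingle j (-1) * ε : ι → ℤˣ) i : ℤˣ) : ℤ) : ℝ) =
      ∑ i ∈ s, a i * ((ε i : ℤ) : ℝ) := by
    refine sum_congr rfl fun i hi => ?_
    have : i ≠ j := fun h => hj (h ▸ hi)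
    simp [this]
  simp only [hG, sum_insert hj, h3]
  rcases Int.units_eq_one_or (ε j) with h | h <;> simp [h] <;> ring_nf

/-- The second, fourth and sixth moments of a signed sum. -/
theorem expect_signed_sum_moments (a : ι → ℝ) (s : Finset ι) :
    (𝔼 ε : ι → ℤˣ, (∑ i ∈ s, a i * ((ε i : ℤ) : ℝ)) ^ 2 = ∑ i ∈ s, a i ^ 2) ∧
    (𝔼 ε : ι → ℤˣ, (∑ i ∈ s, a i * ((ε i : ℤ) : ℝ)) ^ 4 =
      3 * (∑ i ∈ s, a i ^ 2) ^ 2 - 2 * ∑ i ∈ s, a i ^ 4) ∧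
    (𝔼 ε : ι → ℤˣ, (∑ i ∈ s, a i * ((ε i : ℤ) : ℝ)) ^ 6 =
      15 * (∑ i ∈ s, a i ^ 2) ^ 3 - 30 * (∑ i ∈ s, a i ^ 2) * (∑ i ∈ s, a i ^ 4) +
        16 * ∑ i ∈ s, a i ^ 6) := by
  induction s using Finset.induction_on with
  | empty => simp
  | insert j s hj ih =>
    obtain ⟨h2, h4, h6⟩ := ih
    refine ⟨?_, ?_, ?_⟩
    · rw [expect_signed_sum_insert a (fun x => x ^ 2) hj]
      have : ∀ r : ℝ, ((r + a j) ^ 2 + (r - a j) ^ 2) / 2 = r ^ 2 + a j ^ 2 := fun r => by ring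
      simp only [this, expect_add_distrib, Fintype.expect_const, h2, sum_insert hj]
      ring
    · rw [expect_signed_sum_insert a (fun x => x ^ 4) hj]
      have : ∀ r : ℝ, ((r + a j) ^ 4 + (r - a j) ^ 4) / 2 =
          r ^ 4 + 6 * a j ^ 2 * r ^ 2 + a j ^ 4 := fun r => by ring
      simp only [this, expect_add_distrib, Fintype.expect_const, ← mul_expect, h2, h4,
        sum_insert hj]
      ring
    · rw [expect_signed_sum_insert a (fun x => x ^ 6) hj]
      have : ∀ r : ℝ, ((r + a j) ^ 6 + (r - a j) ^ 6) / 2 =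
          r ^ 6 + 15 * a j ^ 2 * r ^ 4 + 15 * a j ^ 4 * r ^ 2 + a j ^ 6 := fun r => by ring
      simp only [this, expect_add_distrib, Fintype.expect_const, ← mul_expect, h2, h4, h6,
        sum_insert hj]
      ring

/-! ### Exponential moments of quadratic forms in random signs -/

theorem expect_exp_signed_sum_le (a : ι → ℝ) (c : ℝ) (s : Finset ι) :
    𝔼 ε : ι → ℤˣ, Real.exp (c * ∑ i ∈ s, a i * ((ε i : ℤ) : ℝ)) ≤
      Real.exp (c ^ 2 / 2 * ∑ i ∈ s, a i ^ 2) := by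
  induction s using Finset.induction_on with
  | empty => simp
  | insert j s hj ih =>
    rw [expect_signed_sum_insert a (fun x => Real.exp (c * x)) hj]
    have : ∀ r : ℝ, (Real.exp (c * (r + a j)) + Real.exp (c * (r - a j))) / 2 =
        Real.exp (c * r) * Real.cosh (c * a j) := fun r => by
      rw [Real.cosh_eq, mul_add, mul_sub, Real.exp_add, sub_eq_add_neg, Real.exp_add]
      ring
    simp only [this, ← expect_mul, sum_insert hj]
    calc _ ≤ Real.exp (c ^ 2 / 2 * ∑ i ∈ s, a i ^ 2) * Real.exp ((c * a j) ^ 2 / 2) := by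
          gcongr
          exact Real.cosh_le_exp_half_sq _
      _ = _ := by rw [← Real.exp_add]; congr 1; ring

/-- Completing the square in a Gaussian integral linearizes `exp (s ^ 2 / 3)` in `s`. -/
theorem integral_exp_linearize_sq (s : ℝ) :
    ∫ x : ℝ, Real.exp (-x ^ 2 + 2 / √3 * s * x) = √Real.pi * Real.exp (s ^ 2 / 3) := by
  have h3 : √3 ^ 2 = (3 : ℝ) := Real.sq_sqrt (by norm_num)
  have h0 : √3 ≠ (0 : ℝ) := by positivity
  have : ∀ x : ℝ, Real.exp (-x ^ 2 + 2 / √3 * s * x) =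
      Real.exp (-1 * (x - s / √3) ^ 2) * Real.exp (s ^ 2 / 3) := fun x => by
    rw [← Real.exp_add]
    congr 1
    have : s ^ 2 / 3 = (s / √3) ^ 2 := by rw [div_pow, h3]
    rw [this]
    ring
  simp only [this, MeasureTheory.integral_mul_const]
  rw [MeasureTheory.integral_sub_right_eq_self (fun x : ℝ => Real.exp (-1 * x ^ 2)),
    integral_gaussian, div_one]

theorem integrable_exp_linearize_sq (s : ℝ) :
    MeasureTheory.Integrable fun x : ℝ => Real.exp (-x ^ 2 + 2 / √3 * s * x) := by
  by_contra h
  have := integral_exp_linearize_sq s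
  rw [MeasureTheory.integral_undef h] at this
  have : 0 < √Real.pi * Real.exp (s ^ 2 / 3) := by positivity
  linarith

/-- A signed sum of unit variance satisfies `𝔼 exp (s² / 3) ≤ √3`, the value attained by a standard
Gaussian variable. -/
theorem expect_exp_sq_div_three_le (a : ι → ℝ) (ha : ∑ i, a i ^ 2 = 1) :
    𝔼 ε : ι → ℤˣ, Real.exp ((∑ i, a i * ((ε i : ℤ) : ℝ)) ^ 2 / 3) ≤ √3 := by
  have hpi : 0 < √Real.pi := by positivity
  refine le_of_mul_le_mul_left ?_ hpi
  have h3 : √3 ^ 2 = (3 : ℝ) := Real.sq_sqrt (by norm_num)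
  have hg : MeasureTheory.Integrable fun x : ℝ => Real.exp (-(1 / 3) * x ^ 2) :=
    integrable_exp_neg_mul_sq (by norm_num)
  calc _ = ∫ x : ℝ, 𝔼 ε : ι → ℤˣ,
        Real.exp (-x ^ 2 + 2 / √3 * (∑ i, a i * ((ε i : ℤ) : ℝ)) * x) := by
        simp only [Fintype.expect_eq_sum_div_card]
        rw [MeasureTheory.integral_div,
          MeasureTheory.integral_finsetSum _ fun ε _ => integrable_exp_linearize_sq _]
        simp only [integral_exp_linearize_sq, ← mul_sum, mul_div_assoc]
    _ ≤ ∫ x : ℝ, Real.exp (-(1 / 3) * x ^ 2) := by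
        refine MeasureTheory.integral_mono ?_ hg fun x => ?_
        · simp only [Fintype.expect_eq_sum_div_card]
          exact (MeasureTheory.integrable_finsetSum _ fun ε _ =>
            integrable_exp_linearize_sq _).div_const _
        · have h := expect_exp_signed_sum_le a (2 / √3 * x) univ
          have h2 : ∀ r : ℝ, Real.exp (-x ^ 2 + 2 / √3 * r * x) =
              Real.exp (-x ^ 2) * Real.exp (2 / √3 * x * r) := fun r => by
            rw [← Real.exp_add]; congr 1; ring
          simp only [h2, ← mul_expect]
          calc _ ≤ Real.exp (-x ^ 2) * Real.exp ((2 / √3 * x) ^ 2 / 2 * ∑ i, a i ^ 2) := by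
                gcongr
            _ = _ := by
                rw [← Real.exp_add, ha, mul_pow, div_pow, h3]
                congr 1
                ring
    _ = √Real.pi * √3 := by
        rw [integral_gaussian, ← Real.sqrt_mul Real.pi_pos.le]
        congr 1
        ring

/-- Rescaled form of `expect_exp_sq_div_three_le`. For `a = 0` the exponent is `0 / 0 = 0`. -/
theorem expect_exp_sq_div_le (a : ι → ℝ) :
    𝔼 ε : ι → ℤˣ, Real.exp ((∑ i, a i * ((ε i : ℤ) : ℝ)) ^ 2 / (3 * ∑ i, a i ^ 2)) ≤ √3 := by
  rcases (sum_nonneg fun i _ => sq_nonneg (a i) : 0 ≤ ∑ i, a i ^ 2).eq_or_lt with h | h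
  · simp only [← h, mul_zero, div_zero, Real.exp_zero, Fintype.expect_const]
    exact Real.one_le_sqrt.2 (by norm_num)
  · have hs : √(∑ i, a i ^ 2) ^ 2 = ∑ i, a i ^ 2 := Real.sq_sqrt h.le
    have h1 : ∑ i, (a i / √(∑ i, a i ^ 2)) ^ 2 = 1 := by
      simp_rw [div_pow, hs, ← sum_div, div_self h.ne']
    refine le_of_eq_of_le (expect_congr rfl fun ε _ => ?_) (expect_exp_sq_div_three_le _ h1)
    simp_rw [div_mul_eq_mul_div, ← sum_div, div_pow, hs, div_div, mul_comm (3 : ℝ)]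

/-- The exponential moment bound for a positive semidefinite quadratic form in random signs, written
as a sum of squares of the linear forms with coefficient vectors `v j`: by convexity of `exp` it
reduces to the case of a single square. -/
theorem expect_exp_sum_sq_div_le {κ : Type*} [Fintype κ] (v : κ → ι → ℝ) :
    𝔼 ε : ι → ℤˣ, Real.exp ((∑ j, (∑ i, v j i * ((ε i : ℤ) : ℝ)) ^ 2) /
      (3 * ∑ j, ∑ i, v j i ^ 2)) ≤ √3 := by
  set p : κ → ℝ := fun j => ∑ i, v j i ^ 2 with hp
  have hp0 : ∀ j, 0 ≤ p j := fun j => sum_nonneg fun i _ => sq_nonneg _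
  rcases (sum_nonneg fun j _ => hp0 j : 0 ≤ ∑ j, p j).eq_or_lt with h | h
  · simp only [hp] at h
    simp only [hp, ← h, mul_zero, div_zero, Real.exp_zero, Fintype.expect_const]
    exact Real.one_le_sqrt.2 (by norm_num)
  have hw : ∑ j, p j / ∑ j, p j = 1 := by rw [← sum_div, div_self h.ne']
  calc _ ≤ 𝔼 ε : ι → ℤˣ, ∑ j, p j / (∑ j, p j) *
        Real.exp ((∑ i, v j i * ((ε i : ℤ) : ℝ)) ^ 2 / (3 * p j)) := by
        refine expect_le_expect fun ε _ => ?_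
        have := convexOn_exp.map_sum_le (t := univ) (w := fun j => p j / ∑ j, p j)
          (p := fun j => (∑ i, v j i * ((ε i : ℤ) : ℝ)) ^ 2 / (3 * p j))
          (fun j _ => div_nonneg (hp0 j) h.le) hw (fun _ _ => Set.mem_univ _)
        refine le_trans (le_of_eq ?_) this
        congr 1
        rw [sum_div]
        refine sum_congr rfl fun j _ => ?_
        rcases (hp0 j).eq_or_lt with hj | hj
        · have hv : ∀ i, v j i = 0 := fun i => by
            have := (sum_eq_zero_iff_of_nonneg (fun i _ => sq_nonneg (v j i))).1 hj.symm i
              (mem_univ i)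
            exact pow_eq_zero_iff two_ne_zero |>.1 this
          simp [hv]
        · simp only [smul_eq_mul]
          field_simp
    _ = ∑ j, p j / (∑ j, p j) * 𝔼 ε : ι → ℤˣ,
          Real.exp ((∑ i, v j i * ((ε i : ℤ) : ℝ)) ^ 2 / (3 * p j)) := by
        rw [expect_sum_comm]
        simp only [mul_expect]
    _ ≤ ∑ j, p j / (∑ j, p j) * √3 := by
        gcongr with j
        exact expect_exp_sq_div_le (v j)
    _ = √3 := by rw [← sum_mul, hw, one_mul]

/-! ### Small values of signed sums -/

/-- A signed sum of unit variance lies in `[-1, 1]` with probability at least `1 / 3`. -/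
theorem one_third_le_expect_abs_le_one (a : ι → ℝ) (ha : ∑ i, a i ^ 2 = 1) :
    1 / 3 ≤ 𝔼 ε : ι → ℤˣ, if |∑ i, a i * ((ε i : ℤ) : ℝ)| ≤ 1 then (1 : ℝ) else 0 := by
  obtain ⟨h2, h4, h6⟩ := expect_signed_sum_moments a univ
  by_cases hbig : ∃ j, 1 / 4 < a j ^ 2
  · -- Changing the sign of a large coefficient moves the sum `±a j + r` across the origin: one of
    -- the two values lies in `[-1, 1]` unless `1 + |a j| < |r|`, an event controlled by Chebyshev.
    obtain ⟨j, hj⟩ := hbig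
    set S : (ι → ℤˣ) → ℝ := fun ε => ∑ i, a i * ((ε i : ℤ) : ℝ) with hS
    set I : (ι → ℤˣ) → ℝ := fun ε => if |S ε| ≤ 1 then (1 : ℝ) else 0 with hI
    set g : ι → ℤˣ := Pi.mulSingle j (-1) with hg
    have hb : 1 / 2 ≤ |a j| := by
      rw [← sq_abs] at hj
      nlinarith [abs_nonneg (a j)]
    have hb1 : |a j| ≤ 1 := by
      have : a j ^ 2 ≤ ∑ i, a i ^ 2 :=
        single_le_sum (f := fun i => a i ^ 2) (fun i _ => sq_nonneg (a i)) (mem_univ j)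
      rw [ha] at this
      exact (sq_le_one_iff_abs_le_one _).1 this
    have hpt : ∀ ε, 1 - ((S ε ^ 2 + S (g * ε) ^ 2) / 2 - a j ^ 2) / (1 + |a j|) ^ 2 ≤
        I ε + I (g * ε) := by
      intro ε
      obtain ⟨r, hr⟩ : ∃ r, r = ∑ i ∈ univ.erase j, a i * ((ε i : ℤ) : ℝ) := ⟨_, rfl⟩
      have hr' : r = ∑ i ∈ univ.erase j, a i * ((((g * ε) i : ℤˣ) : ℤ) : ℝ) := by
        rw [hr]
        refine sum_congr rfl fun i hi => ?_
        simp [hg, ne_of_mem_erase hi]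
      obtain ⟨b, hbS, hbS', hbb⟩ : ∃ b, S ε = r + b ∧ S (g * ε) = r - b ∧ |b| = |a j| := by
        refine ⟨a j * ((ε j : ℤ) : ℝ), ?_, ?_, ?_⟩
        · simp only [hS]
          rw [← sum_erase_add _ _ (mem_univ j), ← hr]
        · simp only [hS]
          rw [← sum_erase_add _ _ (mem_univ j), ← hr']
          simp [hg]
          ring
        · rcases Int.units_eq_one_or (ε j) with h | h <;> simp [h]
      have hq : (S ε ^ 2 + S (g * ε) ^ 2) / 2 - a j ^ 2 = r ^ 2 := by
        rw [hbS, hbS', ← sq_abs (a j), ← hbb, sq_abs]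
        ring
      have hI0 : ∀ ε, 0 ≤ I ε := fun ε => by simp only [hI]; split_ifs <;> norm_num
      rw [hq]
      by_cases hrb : |r| ≤ 1 + |a j|
      · have hor : |r + b| ≤ 1 ∨ |r - b| ≤ 1 := by
          rw [← hbb] at hrb hb1
          rcases abs_cases r with ⟨h, _⟩ | ⟨h, _⟩ <;> rcases abs_cases b with ⟨h', _⟩ | ⟨h', _⟩ <;>
            rw [h, h'] at hrb <;> rw [h'] at hb1 <;>
            first
            | exact Or.inl (abs_le.2 ⟨by linarith, by linarith⟩)
            | exact Or.inr (abs_le.2 ⟨by linarith, by linarith⟩)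
        have h1 : 0 ≤ r ^ 2 / (1 + |a j|) ^ 2 := by positivity
        rcases hor with h | h
        · have : I ε = 1 := by simp only [hI, hbS, if_pos h]
          linarith [hI0 (g * ε)]
        · have : I (g * ε) = 1 := by simp only [hI, hbS', if_pos h]
          linarith [hI0 ε]
      · have : 1 ≤ r ^ 2 / (1 + |a j|) ^ 2 := by
          rw [le_div_iff₀ (by positivity), one_mul, ← sq_abs r]
          have := abs_nonneg (a j)
          gcongr
          exact (not_le.1 hrb).le
        linarith [hI0 ε, hI0 (g * ε)]
    have hE := expect_le_expect fun ε (_ : ε ∈ univ) => hpt ε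
    simp only [expect_add_distrib, expect_sub_distrib, ← expect_div, Fintype.expect_const] at hE
    rw [expect_flip_sign g I, expect_flip_sign g (fun ε => S ε ^ 2), h2, ha,
      ← sq_abs (a j)] at hE
    have h5 : (1 + |a j|) ^ 2 ≠ 0 := by positivity
    have h7 : ((1 + 1) / 2 - |a j| ^ 2) / (1 + |a j|) ^ 2 ≤ 1 / 3 := by
      rw [div_le_iff₀ (by positivity)]
      nlinarith
    linarith
  · -- The polynomial `(1 - y) (1 - y / 6) ^ 2` minorizes the indicator function of `y ≤ 1` on
    -- `y ≥ 0`; its expectation at `y = s ^ 2` only involves the first six moments.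
    push Not at hbig
    calc (1 : ℝ) / 3 ≤ 1 / 3 + (∑ i, a i ^ 4 - 4 * ∑ i, a i ^ 6) / 9 := by
          have : 4 * ∑ i, a i ^ 6 ≤ ∑ i, a i ^ 4 := by
            rw [mul_sum]
            refine sum_le_sum fun i _ => ?_
            have := hbig i
            have h0 : 0 ≤ a i ^ 4 := by positivity
            nlinarith
          linarith
      _ = 𝔼 ε : ι → ℤˣ, (1 - 4 / 3 * (∑ i, a i * ((ε i : ℤ) : ℝ)) ^ 2 +
            13 / 36 * (∑ i, a i * ((ε i : ℤ) : ℝ)) ^ 4 -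
            1 / 36 * (∑ i, a i * ((ε i : ℤ) : ℝ)) ^ 6) := by
          simp only [expect_add_distrib, expect_sub_distrib, ← mul_expect, Fintype.expect_const,
            h2, h4, h6, ha]
          ring
      _ ≤ _ := by
          refine expect_le_expect fun ε _ => ?_
          generalize ∑ i, a i * ((ε i : ℤ) : ℝ) = x
          have hx : 1 - 4 / 3 * x ^ 2 + 13 / 36 * x ^ 4 - 1 / 36 * x ^ 6 =
              (1 - x ^ 2) * (1 - x ^ 2 / 6) ^ 2 := by ring
          rw [hx]
          split_ifs with h
          · have h1 : x ^ 2 ≤ 1 := (sq_le_one_iff_abs_le_one _).2 h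
            have h0 := sq_nonneg x
            have h3 : (1 - x ^ 2 / 6) ^ 2 ≤ 1 := by
              rw [sq_le_one_iff_abs_le_one, abs_le]
              constructor <;> linarith
            nlinarith [sq_nonneg (1 - x ^ 2 / 6)]
          · have h1 : 1 < x ^ 2 := by
              by_contra h'
              exact h ((sq_le_one_iff_abs_le_one _).1 (not_lt.1 h'))
            exact mul_nonpos_of_nonpos_of_nonneg (by linarith) (sq_nonneg _)

/-- Some choice of signs makes a signed sum of unit variance at most `1` in absolute value and at the
same time keeps each of `K` sums of squares of signed sums below `3 log (6 K)` times its mean. Each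
of the latter requirements costs `√3 / (6 K)` in probability, and `√3 / 6 < 1 / 3`. -/
theorem exists_signs_abs_le_one_and_sum_sq_le {K : ℕ} (hK : 1 ≤ K) {κ : Type*} [Fintype κ]
    (a : ι → ℝ) (ha : ∑ i, a i ^ 2 = 1) (v : Fin K → κ → ι → ℝ) :
    ∃ ε : ι → ℤˣ, |∑ i, a i * ((ε i : ℤ) : ℝ)| ≤ 1 ∧ ∀ k,
      ∑ j, (∑ i, v k j i * ((ε i : ℤ) : ℝ)) ^ 2 ≤
        3 * Real.log (6 * K) * ∑ j, ∑ i, v k j i ^ 2 := by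
  have hK0 : (0 : ℝ) < 6 * K := by
    have : (1 : ℝ) ≤ K := by exact_mod_cast hK
    linarith
  set e : (ι → ℤˣ) → Fin K → ℝ := fun ε k =>
    Real.exp ((∑ j, (∑ i, v k j i * ((ε i : ℤ) : ℝ)) ^ 2) / (3 * ∑ j, ∑ i, v k j i ^ 2)) with he
  have hE : 0 < 𝔼 ε : ι → ℤˣ, ((if |∑ i, a i * ((ε i : ℤ) : ℝ)| ≤ 1 then (1 : ℝ) else 0) -
      ∑ k, e ε k / (6 * K)) := by
    rw [expect_sub_distrib, expect_sum_comm]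
    have h1 := one_third_le_expect_abs_le_one a ha
    have h2 : ∑ k, 𝔼 ε, e ε k / (6 * K) ≤ ∑ _k : Fin K, √3 / (6 * K) := by
      refine sum_le_sum fun k _ => ?_
      rw [← expect_div]
      gcongr
      exact expect_exp_sum_sq_div_le (v k)
    have h3 : ∑ _k : Fin K, √3 / (6 * K) = √3 / 6 := by
      rw [sum_const, card_univ, Fintype.card_fin, nsmul_eq_mul]
      field_simp
    have h4 : √3 < 2 := by
      rw [Real.sqrt_lt' (by norm_num)]
      norm_num
    linarith
  obtain ⟨ε, -, hε⟩ := exists_lt_of_lt_expect univ_nonempty hE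
  have he0 : ∀ k, 0 ≤ e ε k / (6 * K) := fun k => div_nonneg (Real.exp_nonneg _) hK0.le
  refine ⟨ε, ?_, fun k => ?_⟩
  · by_contra h
    rw [if_neg h] at hε
    linarith [sum_nonneg fun k (_ : k ∈ univ) => he0 k]
  · have h1 : e ε k / (6 * K) < 1 := by
      have h2 := single_le_sum (fun k _ => he0 k) (mem_univ k)
      split_ifs at hε <;> linarith
    rw [div_lt_one hK0] at h1
    have h2 := (Real.lt_log_iff_exp_lt hK0).2 h1
    have hp : ∀ j, 0 ≤ ∑ i, v k j i ^ 2 := fun j => sum_nonneg fun i _ => sq_nonneg _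
    rcases (sum_nonneg fun j _ => hp j : 0 ≤ ∑ j, ∑ i, v k j i ^ 2).eq_or_lt with h | h
    · have hv : ∀ j i, v k j i = 0 := fun j i => by
        have h3 := (sum_eq_zero_iff_of_nonneg fun j _ => hp j).1 h.symm j (mem_univ j)
        have := (sum_eq_zero_iff_of_nonneg fun i _ => sq_nonneg (v k j i)).1 h3 i (mem_univ i)
        exact pow_eq_zero_iff two_ne_zero |>.1 this
      simp [hv]
    · rw [div_lt_iff₀ (by positivity)] at h2
      linarith

end Rademacher

/-! ### Separation from the positive semidefinite cone -/

section PosSemidef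

variable {ι : Type*}

theorem Matrix.convex_setOf_posSemidef : Convex ℝ {A : Matrix ι ι ℝ | A.PosSemidef} :=
  fun _ hA _ hB _ _ ha hb _ => (PosSemidef.smul hA ha).add (PosSemidef.smul hB hb)

variable [Fintype ι]

theorem Matrix.isClosed_setOf_posSemidef : IsClosed {A : Matrix ι ι ℝ | A.PosSemidef} := by
  simp only [posSemidef_iff_dotProduct_mulVec, Set.ofPred_and, Set.ofPred_forall]
  refine IsClosed.inter ?_ (isClosed_iInter fun x => ?_)
  · exact isClosed_eq (by fun_prop) continuous_id
  · exact isClosed_le continuous_const (by fun_prop)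

variable [DecidableEq ι]

theorem Matrix.exists_trace_mul_eq (f : Matrix ι ι ℝ →ₗ[ℝ] ℝ) :
    ∃ Z : Matrix ι ι ℝ, ∀ A, f A = (Z * A).trace := by
  refine ⟨of fun j i => f (single i j 1), fun A => ?_⟩
  conv_lhs => rw [matrix_eq_sum_single A]
  simp only [map_sum, trace, diag, mul_apply, of_apply]
  rw [Finset.sum_comm]
  refine Finset.sum_congr rfl fun j _ => Finset.sum_congr rfl fun i _ => ?_
  have : single i j (A i j) = A i j • single i j (1 : ℝ) := by simp [smul_single]
  rw [this, map_smul, smul_eq_mul, mul_comm]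

/-- A nonempty compact convex set of symmetric matrices without positive semidefinite elements is
strictly separated from the (self-dual) positive semidefinite cone by a positive semidefinite
matrix. -/
theorem Matrix.exists_posSemidef_trace_mul_le {G : Set (Matrix ι ι ℝ)} (hGc : Convex ℝ G)
    (hGk : IsCompact G) (hGs : ∀ A ∈ G, A.IsSymm) (hG : ∀ A ∈ G, ¬ A.PosSemidef) :
    ∃ Z : Matrix ι ι ℝ, Z.PosSemidef ∧ ∃ δ > 0, ∀ A ∈ G, (Z * A).trace ≤ -δ := by
  have : LocallyConvexSpace ℝ (Matrix ι ι ℝ) :=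
    inferInstanceAs (LocallyConvexSpace ℝ (ι → ι → ℝ))
  obtain ⟨f, u, v, hfu, huv, hfv⟩ := geometric_hahn_banach_compact_closed hGc hGk
    convex_setOf_posSemidef isClosed_setOf_posSemidef (Set.disjoint_left.2 hG)
  have hv : v < 0 := by simpa using hfv 0 PosSemidef.zero
  have hf : ∀ A : Matrix ι ι ℝ, A.PosSemidef → 0 ≤ f A := by
    intro A hA
    by_contra h
    push Not at h
    have h1 := hfv ((v / f A) • A) (hA.smul (div_nonneg_of_nonpos hv.le h.le))
    rw [map_smul, smul_eq_mul, div_mul_cancel₀ _ h.ne] at h1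
    exact h1.false
  obtain ⟨Y, hY⟩ := exists_trace_mul_eq f.toLinearMap
  have hY' : ∀ A, f A = (Y * A).trace := hY
  have hsym : ∀ A : Matrix ι ι ℝ, A.IsSymm → (((1 / 2 : ℝ) • (Y + Yᵀ)) * A).trace = f A := by
    intro A hA
    have h1 : (Yᵀ * A).trace = (Y * A).trace := by
      rw [← trace_transpose, transpose_mul, transpose_transpose, hA.eq, trace_mul_comm]
    rw [smul_mul, trace_smul, add_mul, trace_add, h1, hY', smul_eq_mul]
    ring
  refine ⟨(1 / 2 : ℝ) • (Y + Yᵀ), .of_dotProduct_mulVec_nonneg ?_ fun x => ?_, -u, by linarith,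
    fun A hA => ?_⟩
  · simp [IsHermitian, add_comm]
  · have h1 := hf (vecMulVec x x) (by simpa using posSemidef_vecMulVec_self_star x)
    rw [← hsym _ (by simp [IsSymm, transpose_vecMulVec]), mul_vecMulVec, trace_vecMulVec] at h1
    simpa [dotProduct_comm] using h1
  · rw [hsym A (hGs A hA), neg_neg]
    exact (hfu A hA).le

/-! ### Rounding of positive semidefinite matrices -/

open scoped MatrixOrder in
theorem Matrix.PosSemidef.exists_eq_transpose_mul_self {A : Matrix ι ι ℝ} (hA : A.PosSemidef) :
    ∃ L : Matrix ι ι ℝ, A = Lᵀ * L := by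
  obtain ⟨L, hL⟩ := CStarAlgebra.nonneg_iff_eq_star_mul_self.1 hA.nonneg
  exact ⟨L, by simpa [star_eq_conjTranspose] using hL⟩

/-- The factor `C` of `Z = C Cᵀ` is determined up to an orthogonal matrix on the right; this freedom
is used to diagonalize the quadratic form of `B` in the coordinates given by `C`. -/
theorem Matrix.PosSemidef.exists_factor_diagonalizing {Z B : Matrix ι ι ℝ} (hZ : Z.PosSemidef)
    (hB : B.IsSymm) :
    ∃ (C : Matrix ι ι ℝ) (d : ι → ℝ), Z = C * Cᵀ ∧ Cᵀ * B * C = diagonal d := by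
  obtain ⟨L, hL⟩ := hZ.exists_eq_transpose_mul_self
  have hH : (L * B * Lᵀ).IsHermitian := by
    simp [IsHermitian, transpose_mul, hB.eq, Matrix.mul_assoc]
  set U : Matrix ι ι ℝ := (hH.eigenvectorUnitary : Matrix ι ι ℝ) with hU
  have hUU : U * Uᵀ = 1 := by
    simpa [star_eq_conjTranspose] using (Unitary.mem_iff.1 hH.eigenvectorUnitary.2).2
  refine ⟨Lᵀ * U, hH.eigenvalues, ?_, ?_⟩
  · rw [transpose_mul, transpose_transpose, Matrix.mul_assoc, ← Matrix.mul_assoc U, hUU,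
      Matrix.one_mul, hL]
  · have h := hH.conjStarAlgAut_star_eigenvectorUnitary
    rw [Unitary.conjStarAlgAut_star_apply] at h
    have h' : Uᵀ * (L * B * Lᵀ) * U = diagonal hH.eigenvalues := by
      simpa [star_eq_conjTranspose, Function.comp_def] using h
    rw [← h', transpose_mul, transpose_transpose]
    simp only [Matrix.mul_assoc]

/-- Randomized rounding of a positive semidefinite matrix `Z` with `Z i₀ i₀ = 1`: there is a vector
`w` for which the rank-one matrix `w wᵀ` has the same pairing with `B` as `Z`, satisfies
`(w wᵀ) i₀ i₀ ≤ 1`, and its pairings with the `K` positive semidefinite matrices `A k` exceed those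
of `Z` by at most the factor `3 log (6 K)`. The vector is `C ε` with a sign vector `ε` and
`Z = C Cᵀ`, where `Cᵀ B C` is diagonal, so that the pairing with `B` does not depend on `ε`. -/
theorem Matrix.PosSemidef.exists_rounding {K : ℕ} (hK : 1 ≤ K) {Z B : Matrix ι ι ℝ}
    (hZ : Z.PosSemidef) (hB : B.IsSymm) {i₀ : ι} (hi₀ : Z i₀ i₀ = 1)
    {A : Fin K → Matrix ι ι ℝ} (hA : ∀ k, (A k).PosSemidef) :
    ∃ w : ι → ℝ, w ⬝ᵥ (B *ᵥ w) = (Z * B).trace ∧ |w i₀| ≤ 1 ∧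
      ∀ k, w ⬝ᵥ (A k *ᵥ w) ≤ 3 * Real.log (6 * K) * (Z * A k).trace := by
  obtain ⟨C, d, hC, hd⟩ := hZ.exists_factor_diagonalizing hB
  choose L hL using fun k => (hA k).exists_eq_transpose_mul_self
  have htr : ∀ M : Matrix ι ι ℝ, (Z * M).trace = (Cᵀ * M * C).trace := fun M => by
    rw [hC, Matrix.mul_assoc, trace_mul_comm]
  have hform : ∀ (M : Matrix ι ι ℝ) (e : ι → ℝ),
      (C *ᵥ e) ⬝ᵥ (M *ᵥ (C *ᵥ e)) = e ⬝ᵥ ((Cᵀ * M * C) *ᵥ e) := fun M e => by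
    rw [← mulVec_mulVec, ← mulVec_mulVec, dotProduct_mulVec e, vecMul_transpose]
  have hLC : ∀ k, Cᵀ * A k * C = (L k * C)ᵀ * (L k * C) := fun k => by
    rw [hL k, transpose_mul]
    simp only [Matrix.mul_assoc]
  obtain ⟨ε, h1, h2⟩ := exists_signs_abs_le_one_and_sum_sq_le hK (C i₀) (by
    rw [← hi₀, hC]
    simp [mul_apply, sq]) (fun k => L k * C)
  refine ⟨C *ᵥ fun i => ((ε i : ℤ) : ℝ), ?_, h1, fun k => ?_⟩
  · have hsq : ∀ i, ((ε i : ℤ) : ℝ) * ((ε i : ℤ) : ℝ) = 1 := fun i => by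
      rcases Int.units_eq_one_or (ε i) with h | h <;> simp [h]
    rw [hform, htr, hd, trace_diagonal]
    simp only [dotProduct, mulVec_diagonal]
    refine Finset.sum_congr rfl fun i _ => ?_
    rw [mul_left_comm, hsq, mul_one]
  · rw [hform, htr, hLC, ← mulVec_mulVec, dotProduct_mulVec, vecMul_transpose]
    convert h2 k using 1
    · simp [dotProduct, mulVec, sq]
    · simp only [trace, diag, mul_apply (M := (L k * C)ᵀ), transpose_apply, ← sq]
      rw [Finset.sum_comm]

end PosSemidef

/-! ### Support function of the set of bounds -/

namespace Ellitope

variable {n N K : ℕ} (E : Ellitope n N K)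

theorem dotProduct_le_supportFun (l : Fin K → ℝ) {t : Fin K → ℝ} (ht : t ∈ E.T) :
    l ⬝ᵥ t ≤ E.supportFun l := by
  refine le_csSup ?_ ⟨t, ht, rfl⟩
  exact (E.T_compact.image (by fun_prop)).bddAbove

theorem supportFun_le {l : Fin K → ℝ} {c : ℝ} (h : ∀ t ∈ E.T, l ⬝ᵥ t ≤ c) :
    E.supportFun l ≤ c := by
  refine csSup_le (E.T_nonempty.image _) ?_
  rintro _ ⟨t, ht, rfl⟩
  exact h t ht

theorem mul_supportFun_add_le_iff {ρ : ℝ} (hρ : 0 < ρ) (l : Fin K → ℝ) (τ ξ : ℝ) :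
    ρ * E.supportFun l + τ ≤ ξ ↔ ∀ t ∈ E.T, ρ * (l ⬝ᵥ t) + τ ≤ ξ := by
  constructor
  · intro h t ht
    have := E.dotProduct_le_supportFun l ht
    nlinarith
  · intro h
    have := E.supportFun_le (l := l) (c := (ξ - τ) / ρ) fun t ht => by
      rw [le_div_iff₀ hρ]
      linarith [h t ht]
    rw [le_div_iff₀ hρ] at this
    linarith

theorem exists_mem_pos : ∃ t ∈ E.T, ∀ k, 0 < t k := by
  obtain ⟨t, ht, hti⟩ := E.T_interior
  refine ⟨t, ht, fun k => ?_⟩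
  have h : {t : Fin K → ℝ | 0 ≤ t} = Set.univ.pi fun _ => Set.Ici (0 : ℝ) := by
    ext t
    simp [Pi.le_def]
  rw [h, interior_pi_set Set.finite_univ] at hti
  simpa using hti k (Set.mem_univ k)

theorem zero_mem : (0 : Fin K → ℝ) ∈ E.T := by
  obtain ⟨t, ht⟩ := E.T_nonempty
  exact E.T_monotone 0 t le_rfl (E.T_nonneg ht) ht

/-! ### The homogenized quadratic forms -/

/-- The matrix of the quadratic form `z ↦ zᵀ S k z`, homogenized by an additional coordinate. -/
def liftedS (k : Fin K) : Matrix (Fin N ⊕ Unit) (Fin N ⊕ Unit) ℝ :=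
  fromBlocks (E.S k) 0 0 0

/-- The matrix of the quadratic form `(z, s) ↦ ζᵀ X ζ + 2 s xᵀ ζ` with `ζ = P z`, which homogenizes
the left-hand side of the robust constraint. -/
def liftedObjective (X : Matrix (Fin n) (Fin n) ℝ) (x : Fin n → ℝ) :
    Matrix (Fin N ⊕ Unit) (Fin N ⊕ Unit) ℝ :=
  fromBlocks (E.Pᵀ * X * E.P) (replicateCol Unit (E.Pᵀ *ᵥ x)) (replicateRow Unit (x ᵥ* E.P)) 0

/-- The matrix unit of the homogenizing coordinate. -/
def liftedUnit (N : ℕ) : Matrix (Fin N ⊕ Unit) (Fin N ⊕ Unit) ℝ :=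
  fromBlocks 0 0 0 1

theorem lmiMatrix_eq (X : Matrix (Fin n) (Fin n) ℝ) (x : Fin n → ℝ) (l : Fin K → ℝ) (τ : ℝ) :
    E.lmiMatrix X x l τ =
      ∑ k, l k • E.liftedS k + τ • liftedUnit N - E.liftedObjective X x := by
  ext (i | i) (j | j) <;>
    simp [lmiMatrix, liftedS, liftedUnit, liftedObjective, Matrix.sum_apply]

theorem liftedS_posSemidef (k : Fin K) : (E.liftedS k).PosSemidef := by
  refine .of_dotProduct_mulVec_nonneg ?_ fun w => ?_
  · simp only [liftedS, IsHermitian, fromBlocks_conjTranspose, (E.S_posSemidef k).1.eq,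
      conjTranspose_zero]
  · have := (E.S_posSemidef k).dotProduct_mulVec_nonneg (w ∘ Sum.inl)
    simpa [liftedS, fromBlocks_mulVec, dotProduct, Fintype.sum_sum_type] using this

theorem liftedUnit_posSemidef : (liftedUnit N).PosSemidef := by
  refine .of_dotProduct_mulVec_nonneg ?_ fun w => ?_
  · simp [liftedUnit, IsHermitian, fromBlocks_transpose]
  · simp [liftedUnit, fromBlocks_mulVec, dotProduct, Fintype.sum_sum_type, mul_self_nonneg]

theorem liftedObjective_isSymm {X : Matrix (Fin n) (Fin n) ℝ} (hX : X.IsSymm) (x : Fin n → ℝ) :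
    (E.liftedObjective X x).IsSymm := by
  simp only [liftedObjective, IsSymm, fromBlocks_transpose, transpose_mul, hX.eq,
    transpose_transpose, transpose_replicateCol, transpose_replicateRow, mulVec_transpose,
    transpose_zero, Matrix.mul_assoc]

theorem dotProduct_liftedS_mulVec (k : Fin K) (w : Fin N ⊕ Unit → ℝ) :
    w ⬝ᵥ (E.liftedS k *ᵥ w) = (E.S k *ᵥ (w ∘ Sum.inl)) ⬝ᵥ (w ∘ Sum.inl) := by
  rw [dotProduct_comm (E.S k *ᵥ _)]
  simp [liftedS, fromBlocks_mulVec, dotProduct, Fintype.sum_sum_type]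

theorem dotProduct_liftedObjective_mulVec (X : Matrix (Fin n) (Fin n) ℝ) (x : Fin n → ℝ)
    (w : Fin N ⊕ Unit → ℝ) :
    w ⬝ᵥ (E.liftedObjective X x *ᵥ w) =
      (E.P *ᵥ (w ∘ Sum.inl)) ⬝ᵥ (X *ᵥ (E.P *ᵥ (w ∘ Sum.inl))) +
        2 * (w (Sum.inr ()) * (x ⬝ᵥ (E.P *ᵥ (w ∘ Sum.inl)))) := by
  obtain ⟨z, hz⟩ : ∃ z, z = w ∘ Sum.inl := ⟨_, rfl⟩
  obtain ⟨s, hs⟩ : ∃ s, s = w (Sum.inr ()) := ⟨_, rfl⟩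
  have hw : w = Sum.elim z fun _ => s := by
    ext (i | i) <;> simp [hz, hs]
  rw [← hz, ← hs, hw, liftedObjective, fromBlocks_mulVec]
  simp only [Sum.elim_comp_inl, Sum.elim_comp_inr, sumElim_dotProduct_sumElim, dotProduct_add,
    zero_mulVec, add_zero]
  have h1 : z ⬝ᵥ ((E.Pᵀ * X * E.P) *ᵥ z) = (E.P *ᵥ z) ⬝ᵥ (X *ᵥ (E.P *ᵥ z)) := by
    rw [← mulVec_mulVec, ← mulVec_mulVec, dotProduct_mulVec z, vecMul_transpose]
  have h2 : z ⬝ᵥ (replicateCol Unit (E.Pᵀ *ᵥ x) *ᵥ fun _ => s) = s * (x ⬝ᵥ (E.P *ᵥ z)) := by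
    have : replicateCol Unit (E.Pᵀ *ᵥ x) *ᵥ (fun _ => s) = s • (E.Pᵀ *ᵥ x) := by
      ext i
      simp [mulVec, dotProduct, mul_comm]
    rw [this, dotProduct_smul, smul_eq_mul, dotProduct_mulVec, vecMul_transpose, dotProduct_comm]
  have h3 : (fun _ : Unit => s) ⬝ᵥ (replicateRow Unit (x ᵥ* E.P) *ᵥ z) =
      s * (x ⬝ᵥ (E.P *ᵥ z)) := by
    rw [dotProduct_mulVec x]
    simp [dotProduct, mulVec]
  rw [h1, h2, h3]
  ring

/-! ### Conic duality -/

/-- The multipliers `(l, τ)` that satisfy all constraints of the system except the matrix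
inequality, with the bound `0 ≤ τ` that the latter implies; it makes the set compact. -/
def multiplierSet (ρ ξ : ℝ) : Set ((Fin K → ℝ) × ℝ) :=
  {p | 0 ≤ p.1 ∧ 0 ≤ p.2 ∧ ρ * E.supportFun p.1 + p.2 ≤ ξ}

theorem multiplierSet_eq {ρ : ℝ} (hρ : 0 < ρ) (ξ : ℝ) :
    E.multiplierSet ρ ξ =
      {p | 0 ≤ p.1} ∩ ({p | 0 ≤ p.2} ∩ ⋂ t ∈ E.T, {p | ρ * (p.1 ⬝ᵥ t) + p.2 ≤ ξ}) := by
  ext p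
  simp [multiplierSet, E.mul_supportFun_add_le_iff hρ]

theorem convex_multiplierSet {ρ : ℝ} (hρ : 0 < ρ) (ξ : ℝ) : Convex ℝ (E.multiplierSet ρ ξ) := by
  intro p hp q hq a b ha hb hab
  simp only [multiplierSet, Set.mem_ofPred_eq, E.mul_supportFun_add_le_iff hρ] at hp hq ⊢
  refine ⟨add_nonneg (smul_nonneg ha hp.1) (smul_nonneg hb hq.1),
    add_nonneg (smul_nonneg ha hp.2.1) (smul_nonneg hb hq.2.1), fun t ht => ?_⟩
  have h1 := mul_le_mul_of_nonneg_left (hp.2.2 t ht) ha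
  have h2 := mul_le_mul_of_nonneg_left (hq.2.2 t ht) hb
  have h3 : a * ξ + b * ξ = ξ := by rw [← add_mul, hab, one_mul]
  simp only [Prod.fst_add, Prod.snd_add, Prod.smul_fst, Prod.smul_snd, add_dotProduct,
    smul_dotProduct, smul_eq_mul]
  linarith

theorem isCompact_multiplierSet {ρ : ℝ} (hρ : 0 < ρ) (ξ : ℝ) :
    IsCompact (E.multiplierSet ρ ξ) := by
  obtain ⟨t, ht, htpos⟩ := E.exists_mem_pos
  refine (isCompact_Icc (a := (0 : (Fin K → ℝ) × ℝ))
    (b := (fun k => ξ / (ρ * t k), ξ))).of_isClosed_subset ?_ ?_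
  · rw [multiplierSet_eq E hρ]
    refine IsClosed.inter (isClosed_le continuous_const continuous_fst)
      (IsClosed.inter (isClosed_le continuous_const continuous_snd) ?_)
    exact isClosed_biInter fun t _ => isClosed_le (by fun_prop) continuous_const
  · rintro ⟨l, τ⟩ ⟨hl, hτ, h⟩
    rw [E.mul_supportFun_add_le_iff hρ] at h
    simp only at hl hτ h
    refine ⟨⟨hl, hτ⟩, fun k => ?_, ?_⟩
    · have h1 : l k * t k ≤ l ⬝ᵥ t :=
        Finset.single_le_sum (f := fun k => l k * t k)
          (fun k _ => mul_nonneg (hl k) (htpos k).le) (Finset.mem_univ k)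
      have h2 := h t ht
      have h3 := mul_le_mul_of_nonneg_left h1 hρ.le
      simp only
      rw [le_div_iff₀ (mul_pos hρ (htpos k))]
      linarith
    · simpa using h 0 E.zero_mem

theorem isSymm_lmiMatrix {X : Matrix (Fin n) (Fin n) ℝ} (hX : X.IsSymm) (x : Fin n → ℝ)
    (l : Fin K → ℝ) (τ : ℝ) : (E.lmiMatrix X x l τ).IsSymm := by
  have h1 : ∀ k, (E.liftedS k)ᵀ = E.liftedS k := fun k => by
    simpa [IsHermitian] using (E.liftedS_posSemidef k).1
  have h2 : (liftedUnit N)ᵀ = liftedUnit N := by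
    simpa [IsHermitian] using (liftedUnit_posSemidef (N := N)).1
  simp [IsSymm, lmiMatrix_eq, transpose_sum, h1, h2, (E.liftedObjective_isSymm hX x).eq]

theorem trace_mul_liftedUnit (Z : Matrix (Fin N ⊕ Unit) (Fin N ⊕ Unit) ℝ) :
    (Z * liftedUnit N).trace = Z (Sum.inr ()) (Sum.inr ()) := by
  simp [liftedUnit, trace, mul_apply, Fintype.sum_sum_type]

theorem trace_mul_lmiMatrix (Z : Matrix (Fin N ⊕ Unit) (Fin N ⊕ Unit) ℝ)
    (X : Matrix (Fin n) (Fin n) ℝ) (x : Fin n → ℝ) (l : Fin K → ℝ) (τ : ℝ) :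
    (Z * E.lmiMatrix X x l τ).trace = ∑ k, l k * (Z * E.liftedS k).trace +
      τ * Z (Sum.inr ()) (Sum.inr ()) - (Z * E.liftedObjective X x).trace := by
  rw [lmiMatrix_eq, mul_sub, mul_add, trace_sub, trace_add, Matrix.mul_smul, trace_smul,
    trace_mul_liftedUnit, Finset.mul_sum, trace_sum]
  simp

/-- A vector `s ≥ 0` whose pairings with nonnegative vectors `l` are bounded by `φ_T(l)` belongs to
`T`, because `T` is convex, closed and monotone. -/
theorem mem_of_forall_dotProduct_le {s : Fin K → ℝ} (hs : 0 ≤ s)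
    (h : ∀ l : Fin K → ℝ, 0 ≤ l → ∀ u, (∀ t ∈ E.T, l ⬝ᵥ t ≤ u) → l ⬝ᵥ s ≤ u) : s ∈ E.T := by
  by_contra hsT
  obtain ⟨f, u, hfu, hus⟩ :=
    geometric_hahn_banach_closed_point E.T_convex E.T_compact.isClosed hsT
  obtain ⟨l, hl⟩ : ∃ l : Fin K → ℝ, ∀ t, f t = l ⬝ᵥ t := by
    refine ⟨fun k => f (Pi.single k 1), fun t => ?_⟩
    rw [← ContinuousLinearMap.coe_coe, LinearMap.pi_apply_eq_sum_univ f.toLinearMap t]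
    refine Finset.sum_congr rfl fun k _ => ?_
    rw [smul_eq_mul, mul_comm, ContinuousLinearMap.coe_coe]
    congr 2
    ext j
    simp [Pi.single_apply, eq_comm]
  have h1 : (fun k => max (l k) (0 : ℝ)) ⬝ᵥ s ≤ u := by
    refine h (fun k => max (l k) 0) (fun k => le_max_right _ _) u fun t ht => ?_
    -- Deleting the coordinates of `t` at which `l` is negative leaves a point of `T`.
    have h2 : (fun k => if 0 ≤ l k then t k else 0) ∈ E.T := by
      refine E.T_monotone _ t (fun k => ?_) (fun k => ?_) ht
      · have := E.T_nonneg ht k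
        simp only [Pi.zero_apply] at this ⊢
        split_ifs <;> simp [this]
      · have := E.T_nonneg ht k
        simp only [Pi.zero_apply] at this ⊢
        split_ifs <;> simp [this]
    have h3 := hfu _ h2
    rw [hl] at h3
    refine le_trans (le_of_eq ?_) h3.le
    refine Finset.sum_congr rfl fun k _ => ?_
    dsimp only
    split_ifs with hk
    · rw [max_eq_left hk]
    · rw [max_eq_right (not_le.1 hk).le, zero_mul, mul_zero]
  have h2 : l ⬝ᵥ s ≤ (fun k => max (l k) (0 : ℝ)) ⬝ᵥ s :=
    Finset.sum_le_sum fun k _ => mul_le_mul_of_nonneg_right (le_max_left _ _) (hs k)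
  rw [hl] at hus
  linarith

/-- If a linear functional with coefficients `s ≥ 0`, `κ ≥ 0` stays below `σ` by a margin `δ` on the
set of multipliers, then a multiple of `(s, κ, σ)` satisfies the constraints of the dual problem, with
an objective value above `ξ`. -/
theorem exists_scaling {ρ ξ : ℝ} (hρ : 0 < ρ) (hξ : 0 ≤ ξ) {s : Fin K → ℝ} (hs : 0 ≤ s)
    {κ σ δ : ℝ} (hκ : 0 ≤ κ) (hδ : 0 < δ)
    (h : ∀ p ∈ E.multiplierSet ρ ξ, p.1 ⬝ᵥ s + p.2 * κ ≤ σ - δ) :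
    ∃ c > 0, ∃ t ∈ E.T, (∀ k, c * s k ≤ ρ * t k) ∧ c * κ ≤ 1 ∧ ξ < c * σ := by
  have hmem : ∀ (l : Fin K → ℝ) (τ : ℝ), 0 ≤ l → 0 ≤ τ → (∀ t ∈ E.T, ρ * (l ⬝ᵥ t) + τ ≤ ξ) →
      l ⬝ᵥ s + τ * κ ≤ σ - δ := fun l τ hl hτ hlt =>
    h (l, τ) ⟨hl, hτ, (E.mul_supportFun_add_le_iff hρ l τ ξ).2 hlt⟩
  have hσ : 0 ≤ σ - δ := by
    simpa using hmem 0 0 le_rfl le_rfl (by simpa using fun _ _ => hξ)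
  rcases hξ.eq_or_lt with rfl | hξ
  · obtain ⟨t, ht, htpos⟩ := E.exists_mem_pos
    have hq : ∀ k, 0 ≤ s k / (ρ * t k) := fun k => div_nonneg (hs k) (mul_pos hρ (htpos k)).le
    have hQ := Finset.sum_nonneg fun k (_ : k ∈ Finset.univ) => hq k
    set D := κ + 1 + ∑ k, s k / (ρ * t k) with hD
    have hD0 : 0 < D := by linarith
    refine ⟨1 / D, by positivity, t, ht, fun k => ?_, ?_, ?_⟩
    · have h1 : s k / (ρ * t k) ≤ D :=
        (Finset.single_le_sum (fun k _ => hq k) (Finset.mem_univ k)).trans (by linarith)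
      rw [div_le_iff₀ (mul_pos hρ (htpos k))] at h1
      rw [one_div_mul_eq_div, div_le_iff₀ hD0]
      linarith
    · rw [one_div_mul_eq_div, div_le_one hD0]
      linarith
    · have : 0 < σ := by linarith
      positivity
  · -- Half of the gap `δ` makes the divisor `σ - δ / 2` positive, the other half gives `ξ < c * σ`.
    have hσ' : 0 < σ - δ / 2 := by linarith
    have hc : 0 < ξ / (σ - δ / 2) := by positivity
    refine ⟨ξ / (σ - δ / 2), hc, (ξ / (σ - δ / 2) / ρ) • s, ?_, fun k => ?_, ?_, ?_⟩
    · refine E.mem_of_forall_dotProduct_le (smul_nonneg (by positivity) hs) fun l hl u hu => ?_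
      have hu0 : 0 ≤ u := by simpa using hu 0 E.zero_mem
      rw [dotProduct_smul, smul_eq_mul]
      refine le_of_forall_pos_le_add fun e he => ?_
      have hue : 0 < u + e := by linarith
      obtain ⟨m, hm⟩ : ∃ m, m = ξ / (ρ * (u + e)) := ⟨_, rfl⟩
      have hm0 : 0 ≤ m := hm ▸ by positivity
      have hmξ : ξ = ρ * m * (u + e) := by rw [hm]; field_simp
      have h1 := hmem (m • l) 0 (smul_nonneg hm0 hl) le_rfl fun t ht => by
        rw [smul_dotProduct, smul_eq_mul, add_zero, ← mul_assoc, hmξ]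
        gcongr
        linarith [hu t ht]
      rw [smul_dotProduct, smul_eq_mul, zero_mul, add_zero] at h1
      calc ξ / (σ - δ / 2) / ρ * (l ⬝ᵥ s) = (u + e) * (m * (l ⬝ᵥ s) / (σ - δ / 2)) := by
            rw [hmξ]
            field_simp
        _ ≤ (u + e) * 1 := by
            gcongr
            rw [div_le_one hσ']
            linarith
        _ = u + e := mul_one _
    · simp only [Pi.smul_apply, smul_eq_mul]
      apply le_of_eq
      field_simp
    · have h1 := hmem 0 ξ le_rfl hξ.le (by simp)
      rw [zero_dotProduct, zero_add] at h1
      rw [div_mul_eq_mul_div, div_le_one hσ']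
      linarith
    · rw [div_mul_eq_mul_div, lt_div_iff₀ hσ']
      gcongr
      linarith

/-- Conic duality: if the system is infeasible, then the dual problem has a feasible solution with
an objective value above `ξ`. -/
theorem exists_dual_solution {ρ : ℝ} (hρ : 0 < ρ) {X : Matrix (Fin n) (Fin n) ℝ} (hX : X.IsSymm)
    {x : Fin n → ℝ} {ξ : ℝ} (hξ : 0 ≤ ξ)
    (hS : ¬ ∃ (l : Fin K → ℝ) (τ : ℝ), E.SystemFeasible ρ X x ξ l τ) :
    ∃ Z : Matrix (Fin N ⊕ Unit) (Fin N ⊕ Unit) ℝ, Z.PosSemidef ∧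
      Z (Sum.inr ()) (Sum.inr ()) = 1 ∧
      (∃ t ∈ E.T, ∀ k, (Z * E.liftedS k).trace ≤ ρ * t k) ∧
      ξ < (Z * E.liftedObjective X x).trace := by
  set F : (Fin K → ℝ) × ℝ → Matrix (Fin N ⊕ Unit) (Fin N ⊕ Unit) ℝ :=
    fun p => E.lmiMatrix X x p.1 p.2 with hF
  have hFc : Continuous F := by
    simp only [hF, lmiMatrix_eq]
    fun_prop
  have hFa : ∀ p q : (Fin K → ℝ) × ℝ, ∀ a b : ℝ, a + b = 1 →
      F (a • p + b • q) = a • F p + b • F q := by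
    intro p q a b hab
    have hB : E.liftedObjective X x =
        a • E.liftedObjective X x + b • E.liftedObjective X x := by
      rw [← add_smul, hab, one_smul]
    simp only [hF, lmiMatrix_eq, Prod.fst_add, Prod.snd_add, Prod.smul_fst, Prod.smul_snd,
      Pi.add_apply, Pi.smul_apply, smul_eq_mul, add_smul, Finset.sum_add_distrib, mul_smul,
      ← Finset.smul_sum, smul_sub, smul_add]
    nth_rewrite 1 [hB]
    abel
  obtain ⟨Z, hZ, δ, hδ, hZδ⟩ := exists_posSemidef_trace_mul_le
    (G := F '' E.multiplierSet ρ ξ) (by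
      rintro _ ⟨p, hp, rfl⟩ _ ⟨q, hq, rfl⟩ a b ha hb hab
      exact ⟨a • p + b • q, E.convex_multiplierSet hρ ξ hp hq ha hb hab, hFa p q a b hab⟩)
    ((E.isCompact_multiplierSet hρ ξ).image hFc)
    (by
      rintro _ ⟨p, -, rfl⟩
      exact E.isSymm_lmiMatrix hX x _ _)
    (by
      rintro _ ⟨p, hp, rfl⟩ hpsd
      exact hS ⟨p.1, p.2, hp.1, hpsd, hp.2.2⟩)
  have htrace : ∀ M : Matrix (Fin N ⊕ Unit) (Fin N ⊕ Unit) ℝ, M.PosSemidef →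
      0 ≤ (Z * M).trace := fun M hM => by
    obtain ⟨L, rfl⟩ := hM.exists_eq_transpose_mul_self
    rw [← Matrix.mul_assoc, trace_mul_comm, ← Matrix.mul_assoc]
    simpa using (hZ.mul_mul_conjTranspose_same L).trace_nonneg
  have hκ : 0 ≤ Z (Sum.inr ()) (Sum.inr ()) := hZ.diag_nonneg
  obtain ⟨c, hc, t, ht, hct, hcκ, hcσ⟩ := E.exists_scaling hρ hξ
    (s := fun k => (Z * E.liftedS k).trace) (fun k => htrace _ (E.liftedS_posSemidef k)) hκ hδ
    (σ := (Z * E.liftedObjective X x).trace) (fun p hp => by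
      have := hZδ _ ⟨p, hp, rfl⟩
      rw [hF, trace_mul_lmiMatrix] at this
      simp only [dotProduct]
      linarith)
  -- A multiple of the matrix unit restores the normalization of the homogenizing coordinate.
  refine ⟨c • Z + (1 - c * Z (Sum.inr ()) (Sum.inr ())) • liftedUnit N,
    (hZ.smul hc.le).add (liftedUnit_posSemidef.smul (by linarith)), ?_, ⟨t, ht, fun k => ?_⟩, ?_⟩
  · simp [liftedUnit]
  · refine le_of_eq_of_le ?_ (hct k)
    simp [add_mul, liftedUnit, liftedS, fromBlocks_multiply]
  · refine lt_of_lt_of_eq hcσ ?_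
    have : (liftedUnit N * E.liftedObjective X x).trace = 0 := by
      rw [trace_mul_comm, trace_mul_liftedUnit]
      simp [liftedObjective]
    simp [add_mul, this]

/-! ### Convexity, safety and tightness -/

theorem convex_setOf_systemFeasible {ρ : ℝ} (hρ : 0 < ρ) :
    Convex ℝ {v : Matrix (Fin n) (Fin n) ℝ × (Fin n → ℝ) × ℝ × (Fin K → ℝ) × ℝ |
      v.1.IsSymm ∧ E.SystemFeasible ρ v.1 v.2.1 v.2.2.1 v.2.2.2.1 v.2.2.2.2} := by
  rintro ⟨X, x, ξ, l, τ⟩ ⟨hX, hl, hM, hξ⟩ ⟨X', x', ξ', l', τ'⟩ ⟨hX', hl', hM', hξ'⟩ a b ha hb hab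
  simp only at hX hl hM hξ hX' hl' hM' hξ'
  rw [E.mul_supportFun_add_le_iff hρ] at hξ hξ'
  refine ⟨?_, ?_, ?_, ?_⟩
  · simp [IsSymm, hX.eq, hX'.eq]
  · intro k
    exact add_nonneg (mul_nonneg ha (hl k)) (mul_nonneg hb (hl' k))
  · have : E.lmiMatrix (a • X + b • X') (a • x + b • x') (a • l + b • l') (a • τ + b • τ') =
        a • E.lmiMatrix X x l τ + b • E.lmiMatrix X' x' l' τ' := by
      have hB : E.liftedObjective (a • X + b • X') (a • x + b • x') =
          a • E.liftedObjective X x + b • E.liftedObjective X' x' := by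
        simp only [liftedObjective, fromBlocks_smul, fromBlocks_add, smul_zero, add_zero]
        congr 1
        · simp [Matrix.mul_add, Matrix.add_mul]
        · ext
          simp [mulVec_add, mulVec_smul]
        · ext
          simp [add_vecMul, smul_vecMul]
      simp only [lmiMatrix_eq, hB, Pi.add_apply, Pi.smul_apply, smul_eq_mul, add_smul,
        Finset.sum_add_distrib, mul_smul, ← Finset.smul_sum, smul_sub, smul_add]
      abel
    change (E.lmiMatrix (a • X + b • X') (a • x + b • x') (a • l + b • l')
      (a • τ + b • τ')).PosSemidef
    rw [this]
    exact (hM.smul ha).add (hM'.smul hb)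
  · refine (E.mul_supportFun_add_le_iff hρ _ _ _).2 fun t ht => ?_
    have h1 := mul_le_mul_of_nonneg_left (hξ t ht) ha
    have h2 := mul_le_mul_of_nonneg_left (hξ' t ht) hb
    simp only [Prod.snd_add, Prod.fst_add, Prod.smul_fst, Prod.smul_snd, add_dotProduct,
      smul_dotProduct, smul_eq_mul]
    linarith

/-- The matrix inequality evaluated at `(z, 1)` bounds the objective by
`∑ l k * zᵀ S k z + τ ≤ ρ φ_T(l) + τ`. -/
theorem robustFeasible_of_systemFeasible {ρ : ℝ} (hρ : 0 < ρ) {X : Matrix (Fin n) (Fin n) ℝ}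
    {x : Fin n → ℝ} {ξ : ℝ} {l : Fin K → ℝ} {τ : ℝ} (h : E.SystemFeasible ρ X x ξ l τ) :
    E.RobustFeasible ρ X x ξ := by
  rintro ζ ⟨z, t, ht, rfl, hz⟩
  obtain ⟨hl, hM, hξ⟩ := h
  have h1 := hM.dotProduct_mulVec_nonneg (Sum.elim z fun _ => 1)
  rw [lmiMatrix_eq, star_trivial, sub_mulVec, add_mulVec, sum_mulVec, dotProduct_sub,
    dotProduct_add, dotProduct_sum, dotProduct_liftedObjective_mulVec] at h1
  simp only [smul_mulVec, dotProduct_smul, dotProduct_liftedS_mulVec, Sum.elim_comp_inl,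
    Sum.elim_inr, one_mul, smul_eq_mul] at h1
  have h2 : (Sum.elim z fun _ => (1 : ℝ)) ⬝ᵥ (liftedUnit N *ᵥ Sum.elim z fun _ => (1 : ℝ)) = 1 := by
    simp [liftedUnit, fromBlocks_mulVec, dotProduct]
  have h3 : ∑ k, l k * ((E.S k *ᵥ z) ⬝ᵥ z) ≤ ρ * (l ⬝ᵥ t) := by
    rw [dotProduct, Finset.mul_sum]
    refine Finset.sum_le_sum fun k _ => ?_
    have := mul_le_mul_of_nonneg_left (hz k) (hl k)
    linarith
  have h4 := (E.mul_supportFun_add_le_iff hρ l τ ξ).1 hξ t ht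
  rw [h2] at h1
  linarith

theorem not_robustFeasible_of_not_systemFeasible (hK : 1 ≤ K) {ρ : ℝ} (hρ : 0 < ρ)
    {X : Matrix (Fin n) (Fin n) ℝ} (hX : X.IsSymm) {x : Fin n → ℝ} {ξ : ℝ}
    (hS : ¬ ∃ (l : Fin K → ℝ) (τ : ℝ), E.SystemFeasible ρ X x ξ l τ) :
    ¬ E.RobustFeasible (3 * Real.log (6 * K) * ρ) X x ξ := by
  intro hR
  have hlog : 0 ≤ Real.log (6 * K) := by
    refine Real.log_nonneg ?_
    have : (1 : ℝ) ≤ K := by exact_mod_cast hK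
    linarith
  have hξ : 0 ≤ ξ := by
    have h0 : (0 : Fin n → ℝ) ∈ E.uncertaintySet (3 * Real.log (6 * K) * ρ) :=
      ⟨0, 0, E.zero_mem, by simp, by simp⟩
    simpa using hR 0 h0
  obtain ⟨Z, hZ, hZ1, ⟨t, ht, hZt⟩, hZξ⟩ := E.exists_dual_solution hρ hX hξ hS
  obtain ⟨w, hwB, hw1, hwS⟩ := hZ.exists_rounding hK (E.liftedObjective_isSymm hX x) hZ1
    E.liftedS_posSemidef
  set z := w ∘ Sum.inl with hz
  have hzS : ∀ k, (E.S k *ᵥ z) ⬝ᵥ z ≤ t k * (3 * Real.log (6 * K) * ρ) := fun k => by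
    rw [hz, ← dotProduct_liftedS_mulVec]
    have := mul_le_mul_of_nonneg_left (hZt k) (by positivity : 0 ≤ 3 * Real.log (6 * K))
    linarith [hwS k]
  have h1 := hR (E.P *ᵥ z) ⟨z, t, ht, rfl, hzS⟩
  have h2 := hR (E.P *ᵥ (-z)) ⟨-z, t, ht, rfl, fun k => by
    simpa [mulVec_neg] using hzS k⟩
  rw [← hwB, dotProduct_liftedObjective_mulVec, ← hz] at hZξ
  simp only [mulVec_neg, neg_dotProduct, dotProduct_neg, neg_neg] at h2
  -- One of the points `±P z` beats `w`, since the homogenizing coordinate has modulus at most `1`.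
  have h3 : w (Sum.inr ()) * (x ⬝ᵥ (E.P *ᵥ z)) ≤ |x ⬝ᵥ (E.P *ᵥ z)| := by
    refine (le_abs_self _).trans ?_
    rw [abs_mul]
    exact mul_le_of_le_one_left (abs_nonneg _) hw1
  rcases abs_cases (x ⬝ᵥ (E.P *ᵥ z)) with ⟨h, _⟩ | ⟨h, _⟩ <;> linarith

end Ellitope

theorem theorem1 {n N K : ℕ} (hK : 1 ≤ K) (E : Ellitope n N K) (ρ : ℝ) (hρ : 0 < ρ) :
    -- the constraints of `S[ρ]` are convex in all the variables `X`, `x`, `ξ`, `l`, `τ`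
    Convex ℝ {v : Matrix (Fin n) (Fin n) ℝ × (Fin n → ℝ) × ℝ × (Fin K → ℝ) × ℝ |
      v.1.IsSymm ∧ E.SystemFeasible ρ v.1 v.2.1 v.2.2.1 v.2.2.2.1 v.2.2.2.2} ∧
    -- (i) `S[ρ]` is a safe approximation of `C[ρ]`
    (∀ (X : Matrix (Fin n) (Fin n) ℝ) (x : Fin n → ℝ) (ξ : ℝ), X.IsSymm →
      (∃ (l : Fin K → ℝ) (τ : ℝ), E.SystemFeasible ρ X x ξ l τ) → E.RobustFeasible ρ X x ξ) ∧
    -- (ii) the approximation is tight within the factor `3 ln (6K)`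
    (∀ (X : Matrix (Fin n) (Fin n) ℝ) (x : Fin n → ℝ) (ξ : ℝ), X.IsSymm →
      (¬ ∃ (l : Fin K → ℝ) (τ : ℝ), E.SystemFeasible ρ X x ξ l τ) →
      ¬ E.RobustFeasible (3 * Real.log (6 * K) * ρ) X x ξ) := by
  exact ⟨E.convex_setOf_systemFeasible hρ,
    fun _ _ _ _ ⟨_, _, h⟩ => E.robustFeasible_of_systemFeasible hρ h,
    fun _ _ _ hX hS => E.not_robustFeasible_of_not_systemFeasible hK hρ hX hS⟩
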